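/- For each $n\ge 1$ let $\varepsilon=\varepsilon^{(n)}$ and $w=w^{(n)}$ be random vectors in $\mathbb{R}^n$ on a probability space that may depend on $n$. Put $\sigma^2=n^{-1}\sum_{i=1}^n\mathrm{var}(\varepsilon_i)$ and $V=\sigma^{-2}\mathrm{cov}(\varepsilon)\in\mathbb{R}^{n\times n}$ (so $\mathrm{tr}(V)=n$). Assume that $V$ is positive definite and $\varepsilon=\sigma V^{1/2}w$ almost surely, where $V^{1/2}$ is the positive semidefinite square root and $w_1,\dots,w_n$ are independent with zero mean, unit variance and $\max_{1\le i\le n}\|w_i\|_{\psi_2}\le K_w$ for a constant $K_w>0$ not depending on $n$; here $\|A\|_{\psi_2}=\inf\{t>0: E\exp(A^2/t^2)\le 2\}$. Let $\lambda_1(V)\ge\dots\ge\lambda_n(V)$ be the eigenvalues of $V$, $\lambda_{\max}(V)=\lambda_1(V)$, and $$\delta=\frac{w^{\mathsf T}Vw}{n}=\frac{\varepsilon^{\mathsf T}\varepsilon}{n\sigma^2}.$$ Suppose that $\lambda_{\max}(V)\asymp n^{\iota}$ for some $\iota\in[0,1]$, that is, there are constants $0<m<M<\infty$ with $m\,n^{\iota}\le\lambda_{\max}(V)\le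 M\,n^{\iota}$ for all large $n$. (a) If $\iota\in[0,1)$, then $\delta\to 1$ in probability as $n\to\infty$. (b) Let $\iota=1$. Suppose that for a fixed $K$ there are $\alpha_1,\dots,\alpha_K\in(0,1]$ with $\sum_{i=1}^K\alpha_i\in(0,1]$ such that, as $n\to\infty$, $\lambda_i(V)/n\to\alpha_i$ for $i=1,\dots,K$ and $\lambda_i(V)/n\to 0$ for every $i\ge K+1$. Suppose also that $V_{\mathrm{lo}}\le\mathrm{var}(\varepsilon_i)\le V_{\mathrm{up}}$ for all $n$ and all $i=1,\dots,n$, with constants $V_{\mathrm{lo}},V_{\mathrm{up}}>0$ not depending on $n$ and $i$. Then $$\delta\to\sum_{i=1}^K\alpha_iZ_i^2+\Bigl(1-\sum_{i=1}^K\alpha_i\Bigr)\quad\text{in distribution},$$ where $Z_1,\dots,Z_K$ are independent and identically distributed $\mathcal N(0,1)$. -/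

import Mathlib

open MeasureTheory ProbabilityTheory Filter Topology Asymptotics
open scoped Matrix ENNReal NNReal

namespace CorrelatedErrors

noncomputable section

variable {Ω : Type*} [MeasurableSpace Ω] {n : ℕ}

/-- The sub-Gaussian norm `inf {t > 0 : E exp (X² / t²) ≤ 2}`, with values in `[0, ∞]`
(it is `∞` when no `t` qualifies). -/
def psiTwoNorm (X : Ω → ℝ) (P : Measure Ω) : ℝ≥0∞ :=
  ⨅ (t : ℝ≥0) (_ : 0 < t ∧ ∫⁻ ω, ENNReal.ofReal (Real.exp (X ω ^ 2 / (t : ℝ) ^ 2)) ∂P ≤ 2),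
    (t : ℝ≥0∞)

/-- The average variance `σ² = n⁻¹ ∑ᵢ var (εᵢ)` of a random vector `ε`. -/
def avgVar (ε : Ω → Fin n → ℝ) (P : Measure Ω) : ℝ :=
  (∑ i, variance (fun ω => ε ω i) P) / n

/-- The matrix `V = σ⁻² cov (ε)`. -/
def errV (ε : Ω → Fin n → ℝ) (P : Measure Ω) : Matrix (Fin n) (Fin n) ℝ :=
  (avgVar ε P)⁻¹ • Matrix.of fun i j => covariance (fun ω => ε ω i) (fun ω => ε ω j) P

theorem errV_isHermitian (ε : Ω → Fin n → ℝ) (P : Measure Ω) : (errV ε P).IsHermitian := by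
  ext i j
  simp [errV, covariance_comm]

/-- The eigenvalues of a real symmetric `n × n` matrix in decreasing order, with multiplicity and
numbered from `0`: `eigval hA 0` is the largest one and `eigval hA i` is `λᵢ₊₁(A)`.
The value at an index `i ≥ n` is `0` by convention. -/
def eigval {A : Matrix (Fin n) (Fin n) ℝ} (hA : A.IsHermitian) (i : ℕ) : ℝ :=
  if h : i < n then hA.eigenvalues₀ ⟨i, by simpa using h⟩ else 0

section
open scoped MatrixOrder

/-- The positive semidefinite square root of a positive semidefinite matrix. -/
def matSqrt (A : Matrix (Fin n) (Fin n) ℝ) : Matrix (Fin n) (Fin n) ℝ := CFC.sqrt A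

theorem matSqrt_posSemidef (A : Matrix (Fin n) (Fin n) ℝ) : (matSqrt A).PosSemidef :=
  Matrix.nonneg_iff_posSemidef.mp (CFC.sqrt_nonneg A)

theorem matSqrt_mul_self {A : Matrix (Fin n) (Fin n) ℝ} (hA : A.PosSemidef) :
    matSqrt A * matSqrt A = A :=
  CFC.sqrt_mul_sqrt_self A (Matrix.nonneg_iff_posSemidef.mpr hA)

end

/-- The error vector satisfies `ε = σ V^{1/2} w` almost surely, where `V = σ⁻² cov (ε)` is positive
definite and `w` has independent sub-Gaussian entries with zero mean, unit variance and sub-Gaussian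
norm at most `Kw`. -/
structure SubGaussianErrors (ε w : Ω → Fin n → ℝ) (P : Measure Ω) (Kw : ℝ) : Prop where
  posDef : (errV ε P).PosDef
  eps_eq : ∀ᵐ ω ∂P, ε ω = Real.sqrt (avgVar ε P) • (matSqrt (errV ε P) *ᵥ w ω)
  aemeasurable : ∀ i, AEMeasurable (fun ω => w ω i) P
  indep : iIndepFun (fun i ω => w ω i) P
  mean_zero : ∀ i, ∫ ω, w ω i ∂P = 0
  unit_var : ∀ i, variance (fun ω => w ω i) P = 1
  psiTwo_le : ∀ i, psiTwoNorm (fun ω => w ω i) P ≤ ENNReal.ofReal Kw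

/-- The random variable `δ = wᵀ V w / n`. -/
def delta (ε w : Ω → Fin n → ℝ) (P : Measure Ω) (ω : Ω) : ℝ :=
  (w ω ⬝ᵥ (errV ε P *ᵥ w ω)) / n

/-- The two expressions `εᵀ ε / (n σ²)` and `wᵀ V w / n` for `δ` agree almost surely. -/
theorem delta_eq {ε w : Ω → Fin n → ℝ} {P : Measure Ω} {Kw : ℝ}
    (h : SubGaussianErrors ε w P Kw) :
    ∀ᵐ ω ∂P, (ε ω ⬝ᵥ ε ω) / (n * avgVar ε P) = delta ε w P ω := by
  rcases Nat.eq_zero_or_pos n with rfl | hn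
  · simp [delta]
  have h0 : 0 ≤ avgVar ε P := by
    unfold avgVar
    exact div_nonneg (Finset.sum_nonneg fun i _ => variance_nonneg _ _) (Nat.cast_nonneg _)
  have hne : avgVar ε P ≠ 0 := by
    intro h1
    have h2 := h.posDef.diag_pos (i := ⟨0, hn⟩)
    simp [errV, h1] at h2
  filter_upwards [h.eps_eq] with ω hω
  have hT : (matSqrt (errV ε P))ᵀ = matSqrt (errV ε P) := by
    simpa [Matrix.IsHermitian] using (matSqrt_posSemidef (errV ε P)).isHermitian
  have key : (matSqrt (errV ε P) *ᵥ w ω) ⬝ᵥ (matSqrt (errV ε P) *ᵥ w ω)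
      = w ω ⬝ᵥ (errV ε P *ᵥ w ω) := by
    conv_rhs => rw [← matSqrt_mul_self h.posDef.posSemidef, ← Matrix.mulVec_mulVec,
      Matrix.dotProduct_mulVec, ← Matrix.mulVec_transpose, hT]
  have hn' : (n : ℝ) ≠ 0 := by positivity
  rw [hω, delta, smul_dotProduct, dotProduct_smul, key, smul_eq_mul, smul_eq_mul, ← mul_assoc,
    Real.mul_self_sqrt h0]
  field_simp

end

end CorrelatedErrors

/-!
The law of `δ` is read off the spectral decomposition `V = ∑ₖ λₖ bₖ bₖᵀ` with orthonormal `bₖ`,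
which gives `δ = ∑ₖ (λₖ / n) (bₖ · w)²` with `∑ₖ λₖ / n = 1`.

The first ingredient is a variance bound. For independent standardized `wᵢ` with bounded fourth
moments, which the bound on the sub-Gaussian norms provides, and a symmetric matrix `A`, the
quadratic form `wᵀ A w` has mean `tr A` and variance at most a constant times the squared
Frobenius norm of `A` (`IndepStandardized.integral_quadratic_sq_le`). If `A` is `V / n` with
spectral components of weights `βₖ` removed, this squared norm is `∑ₖ (λₖ / n - βₖ)²`
(`SubGaussianErrors.delta_sub_components`). With `β = 0` the sum is at most
`(λ₁ / n) ∑ₖ λₖ / n = λ₁ / n`, which tends to zero if `ι < 1`, and part (a) is Chebyshev's inequality. With `βₖ = αₖ`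
for `k ≤ K` and `βₖ = 0` beyond, it is at most `∑_{k ≤ K} (λₖ / n - αₖ)² + λ_{K+1} / n`, which
tends to zero under the assumptions of part (b) (`SubGaussianErrors.sum_sq_sub_le`). Hence `δ`
differs from `∑_{k ≤ K} αₖ (bₖ · w)² + (1 - ∑ₖ αₖ)` by a term that tends to zero in `L²`, and such
a term does not matter for convergence in distribution
(`tendstoInDistribution_of_integral_sub_sq`).

The second ingredient is the joint asymptotic normality of `bₖ · w` for `k ≤ K`. The eigenvectors
are delocalized: `λₖ bₖ(i)² ≤ Vᵢᵢ ≤ Vup / Vlo`, while `λₖ → ∞` for `k ≤ K`. So all coefficients of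
a linear combination of the `bₖ · w` are uniformly small, and its characteristic function, a
product over the coordinates, is compared factor by factor with the Gaussian one
(`IndepStandardized.norm_charFun_linear_sub_le`). Lévy's continuity theorem
(`tendstoInDistribution_projections`) and the continuous mapping theorem finish the proof.
-/

namespace CorrelatedErrors

/-! ### Moments of sub-Gaussian variables -/

/-- A finite sub-Gaussian norm controls the fourth moment, because `x⁴ ≤ 2 t⁴ exp (x² / t²)`. -/
theorem integrable_pow_four_of_psiTwoNorm_le {Ω : Type*} [MeasurableSpace Ω] {P : Measure Ω}
    {X : Ω → ℝ} (hX : AEMeasurable X P) {K : ℝ} (hK : 0 < K)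
    (h : psiTwoNorm X P ≤ ENNReal.ofReal K) :
    Integrable (fun ω => X ω ^ 4) P ∧ ∫ ω, X ω ^ 4 ∂P ≤ 4 * (K + 1) ^ 4 := by
  -- The infimum need not be attained, so a slightly larger admissible `t` is used.
  have hlt : psiTwoNorm X P < ENNReal.ofReal (K + 1) :=
    h.trans_lt ((ENNReal.ofReal_lt_ofReal_iff (by linarith)).2 (by linarith))
  simp only [psiTwoNorm, iInf_lt_iff] at hlt
  obtain ⟨t, ⟨ht0, ht⟩, htK⟩ := hlt
  have ht0' : (0 : ℝ) < t := ht0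
  have htK' : (t : ℝ) ≤ K + 1 := by
    rw [← ENNReal.ofReal_coe_nnreal] at htK
    exact ((ENNReal.ofReal_lt_ofReal_iff (by linarith)).1 htK).le
  have hpt : ∀ x : ℝ, x ^ 4 ≤ 2 * (t : ℝ) ^ 4 * Real.exp (x ^ 2 / (t : ℝ) ^ 2) := by
    intro x
    have h1 := Real.quadratic_le_exp_of_nonneg (x := x ^ 2 / (t : ℝ) ^ 2) (by positivity)
    have h2 : x ^ 4 = 2 * (t : ℝ) ^ 4 * ((x ^ 2 / (t : ℝ) ^ 2) ^ 2 / 2) := by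
      field_simp
    rw [h2]
    have h3 : 0 ≤ x ^ 2 / (t : ℝ) ^ 2 := by positivity
    gcongr
    linarith
  have hbound : ∫⁻ ω, ENNReal.ofReal (X ω ^ 4) ∂P ≤ ENNReal.ofReal (4 * (K + 1) ^ 4) := by
    calc ∫⁻ ω, ENNReal.ofReal (X ω ^ 4) ∂P
        ≤ ∫⁻ ω, ENNReal.ofReal (2 * (t : ℝ) ^ 4)
            * ENNReal.ofReal (Real.exp (X ω ^ 2 / (t : ℝ) ^ 2)) ∂P := by
          refine lintegral_mono fun ω => ?_
          rw [← ENNReal.ofReal_mul (by positivity)]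
          exact ENNReal.ofReal_le_ofReal (hpt _)
      _ = ENNReal.ofReal (2 * (t : ℝ) ^ 4)
            * ∫⁻ ω, ENNReal.ofReal (Real.exp (X ω ^ 2 / (t : ℝ) ^ 2)) ∂P :=
          lintegral_const_mul' _ _ ENNReal.ofReal_ne_top
      _ ≤ ENNReal.ofReal (2 * (t : ℝ) ^ 4) * ENNReal.ofReal 2 := by
          gcongr
          simpa using ht
      _ = ENNReal.ofReal (4 * (t : ℝ) ^ 4) := by
          rw [← ENNReal.ofReal_mul (by positivity)]
          ring_nf
      _ ≤ ENNReal.ofReal (4 * (K + 1) ^ 4) := by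
          refine ENNReal.ofReal_le_ofReal ?_
          gcongr
  have hm : AEStronglyMeasurable (fun ω => X ω ^ 4) P := (hX.pow_const 4).aestronglyMeasurable
  have hnn : 0 ≤ᵐ[P] fun ω => X ω ^ 4 := ae_of_all _ fun ω => by positivity
  refine ⟨⟨hm, ?_⟩, ?_⟩
  · rw [hasFiniteIntegral_iff_ofReal hnn]
    exact hbound.trans_lt ENNReal.ofReal_lt_top
  · rw [integral_eq_lintegral_of_nonneg_ae hnn hm]
    exact ENNReal.toReal_le_of_le_ofReal (by positivity) hbound

/-- Independent random variables with mean zero, unit second moment and fourth moments bounded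
by `M`. -/
structure IndepStandardized {Ω ι : Type*} [MeasurableSpace Ω] (W : ι → Ω → ℝ) (P : Measure Ω)
    (M : ℝ) : Prop where
  aemeasurable : ∀ i, AEMeasurable (W i) P
  indep : iIndepFun W P
  mean_zero : ∀ i, ∫ ω, W i ω ∂P = 0
  sq_one : ∀ i, ∫ ω, W i ω ^ 2 ∂P = 1
  integrable_four : ∀ i, Integrable (fun ω => W i ω ^ 4) P
  four_le : ∀ i, ∫ ω, W i ω ^ 4 ∂P ≤ M

theorem SubGaussianErrors.indepStandardized {Ω : Type*} [MeasurableSpace Ω] {n : ℕ}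
    {ε w : Ω → Fin n → ℝ} {P : Measure Ω} {Kw : ℝ} (hK : 0 < Kw)
    (h : SubGaussianErrors ε w P Kw) :
    IndepStandardized (fun i ω => w ω i) P (4 * (Kw + 1) ^ 4) where
  aemeasurable := h.aemeasurable
  indep := h.indep
  mean_zero := h.mean_zero
  sq_one i := by
    rw [← variance_of_integral_eq_zero (h.aemeasurable i) (h.mean_zero i)]
    exact h.unit_var i
  integrable_four i :=
    (integrable_pow_four_of_psiTwoNorm_le (h.aemeasurable i) hK (h.psiTwo_le i)).1
  four_le i := (integrable_pow_four_of_psiTwoNorm_le (h.aemeasurable i) hK (h.psiTwo_le i)).2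

theorem integrable_pow_of_pow_four {Ω : Type*} [MeasurableSpace Ω] {P : Measure Ω}
    [IsFiniteMeasure P] {X : Ω → ℝ} (hX : AEMeasurable X P)
    (h : Integrable (fun ω => X ω ^ 4) P) {k : ℕ} (hk : k ≤ 4) :
    Integrable (fun ω => X ω ^ k) P := by
  refine Integrable.mono' ((integrable_const (1 : ℝ)).add h)
    (hX.pow_const k).aestronglyMeasurable (ae_of_all _ fun ω => ?_)
  have h4 : X ω ^ 4 = |X ω| ^ 4 := (Even.pow_abs ⟨2, rfl⟩ _).symm
  simp only [Pi.add_apply, norm_pow, Real.norm_eq_abs, h4]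
  rcases le_total |X ω| 1 with h1 | h1
  · have := pow_le_one₀ (n := k) (abs_nonneg _) h1
    have : 0 ≤ |X ω| ^ 4 := by positivity
    linarith
  · have := pow_le_pow_right₀ h1 hk
    linarith

/-! ### Second moments of linear and quadratic forms -/

section Forms

variable {Ω : Type*} [MeasurableSpace Ω] {P : Measure Ω} [IsProbabilityMeasure P]

/-- The effect of one new independent coordinate `X` on a centred quadratic form `Q`, with
`S` the linear form that multiplies `X` and `b` the new diagonal entry. -/
theorem integral_sq_add_step {X Q S : Ω → ℝ} {M : ℝ} (b : ℝ)
    (hX : AEMeasurable X P) (hX4 : Integrable (fun ω => X ω ^ 4) P)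
    (h1 : ∫ ω, X ω ∂P = 0) (h2 : ∫ ω, X ω ^ 2 ∂P = 1) (h4 : ∫ ω, X ω ^ 4 ∂P ≤ M)
    (hQ : MemLp Q 2 P) (hS : MemLp S 2 P)
    (hQ0 : ∫ ω, Q ω ∂P = 0) (hS0 : ∫ ω, S ω ∂P = 0)
    (hind : IndepFun X (fun ω => (Q ω, S ω)) P) :
    MemLp (fun ω => Q ω + 2 * X ω * S ω + b * (X ω ^ 2 - 1)) 2 P ∧
    ∫ ω, (Q ω + 2 * X ω * S ω + b * (X ω ^ 2 - 1)) ∂P = 0 ∧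
    ∫ ω, (Q ω + 2 * X ω * S ω + b * (X ω ^ 2 - 1)) ^ 2 ∂P
      ≤ ∫ ω, Q ω ^ 2 ∂P + 4 * ∫ ω, S ω ^ 2 ∂P + M * b ^ 2 := by
  have iX : ∀ k ≤ 4, Integrable (fun ω => X ω ^ k) P :=
    fun k hk => integrable_pow_of_pow_four hX hX4 hk
  have i1 : Integrable X P := by simpa using iX 1 (by norm_num)
  have i2 := iX 2 (by norm_num)
  have i3 := iX 3 (by norm_num)
  have iQ : Integrable Q P := hQ.integrable (by norm_num)
  have iS : Integrable S P := hS.integrable (by norm_num)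
  have iQQ : Integrable (fun ω => Q ω ^ 2) P := hQ.integrable_sq
  have iSS : Integrable (fun ω => S ω ^ 2) P := hS.integrable_sq
  have iQS : Integrable (fun ω => Q ω * S ω) P := hQ.integrable_mul hS
  have ind : ∀ (f : ℝ → ℝ) (g : ℝ × ℝ → ℝ), Measurable f → Measurable g →
      IndepFun (fun ω => f (X ω)) (fun ω => g (Q ω, S ω)) P :=
    fun f g hf hg => hind.comp hf hg
  have d1 : IndepFun X (fun ω => Q ω * S ω) P :=
    ind id (fun p => p.1 * p.2) measurable_id (by fun_prop)
  have d2 : IndepFun (fun ω => X ω ^ 2 - 1) Q P :=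
    ind (fun x => x ^ 2 - 1) (fun p => p.1) (by fun_prop) (by fun_prop)
  have d3 : IndepFun (fun ω => X ω ^ 2) (fun ω => S ω ^ 2) P :=
    ind (fun x => x ^ 2) (fun p => p.2 ^ 2) (by fun_prop) (by fun_prop)
  have d4 : IndepFun (fun ω => X ω ^ 3 - X ω) S P :=
    ind (fun x => x ^ 3 - x) (fun p => p.2) (by fun_prop) (by fun_prop)
  have d5 : IndepFun X S P := ind id (fun p => p.2) measurable_id (by fun_prop)
  have j1 : Integrable (fun ω => X ω * (Q ω * S ω)) P := d1.integrable_mul i1 iQS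
  have iX2 : Integrable (fun ω => X ω ^ 2 - 1) P := i2.sub (integrable_const 1)
  have j2 : Integrable (fun ω => (X ω ^ 2 - 1) * Q ω) P := d2.integrable_mul iX2 iQ
  have j3 : Integrable (fun ω => X ω ^ 2 * S ω ^ 2) P := d3.integrable_mul i2 iSS
  have iX3 : Integrable (fun ω => X ω ^ 3 - X ω) P := i3.sub i1
  have j4 : Integrable (fun ω => (X ω ^ 3 - X ω) * S ω) P := d4.integrable_mul iX3 iS
  have j5 : Integrable (fun ω => X ω * S ω) P := d5.integrable_mul i1 iS
  have j6 : Integrable (fun ω => (X ω ^ 2 - 1) ^ 2) P := by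
    have : Integrable (fun ω => X ω ^ 4 - 2 * X ω ^ 2 + 1) P :=
      (hX4.sub (i2.const_mul 2)).add (integrable_const 1)
    refine this.congr (ae_of_all _ fun ω => ?_)
    simp only
    ring
  have e2' : ∫ ω, (X ω ^ 2 - 1) ∂P = 0 := by
    rw [integral_sub i2 (integrable_const 1), h2]; simp
  have e1 : ∫ ω, X ω * (Q ω * S ω) ∂P = 0 := by
    rw [d1.integral_fun_mul_eq_mul_integral i1.1 iQS.1, h1, zero_mul]
  have e2 : ∫ ω, (X ω ^ 2 - 1) * Q ω ∂P = 0 := by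
    rw [d2.integral_fun_mul_eq_mul_integral iX2.1 iQ.1, hQ0, mul_zero]
  have e3 : ∫ ω, X ω ^ 2 * S ω ^ 2 ∂P = ∫ ω, S ω ^ 2 ∂P := by
    rw [d3.integral_fun_mul_eq_mul_integral i2.1 iSS.1, h2, one_mul]
  have e4 : ∫ ω, (X ω ^ 3 - X ω) * S ω ∂P = 0 := by
    rw [d4.integral_fun_mul_eq_mul_integral iX3.1 iS.1, hS0, mul_zero]
  have e5 : ∫ ω, X ω * S ω ∂P = 0 := by
    rw [d5.integral_fun_mul_eq_mul_integral i1.1 iS.1, h1, zero_mul]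
  have e6 : ∫ ω, (X ω ^ 2 - 1) ^ 2 ∂P ≤ M := by
    have : ∫ ω, (X ω ^ 2 - 1) ^ 2 ∂P = ∫ ω, (X ω ^ 4 - 2 * X ω ^ 2 + 1) ∂P := by
      congr 1; ext ω; ring
    have i2' := i2.const_mul 2
    have i42 : Integrable (fun ω => X ω ^ 4 - 2 * X ω ^ 2) P := hX4.sub i2'
    rw [this, integral_add i42 (integrable_const 1), integral_sub hX4 i2', integral_const_mul, h2]
    simp
    linarith
  have hexp : ∀ ω, (Q ω + 2 * X ω * S ω + b * (X ω ^ 2 - 1)) ^ 2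
      = Q ω ^ 2 + 4 * (X ω * (Q ω * S ω)) + 2 * b * ((X ω ^ 2 - 1) * Q ω)
        + 4 * (X ω ^ 2 * S ω ^ 2) + 4 * b * ((X ω ^ 3 - X ω) * S ω)
        + b ^ 2 * (X ω ^ 2 - 1) ^ 2 := fun ω => by ring
  have k1 : Integrable (fun ω => Q ω ^ 2 + 4 * (X ω * (Q ω * S ω))) P :=
    iQQ.add (j1.const_mul 4)
  have k2 : Integrable (fun ω => Q ω ^ 2 + 4 * (X ω * (Q ω * S ω))
      + 2 * b * ((X ω ^ 2 - 1) * Q ω)) P :=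
    k1.add (j2.const_mul (2 * b))
  have k3 : Integrable (fun ω => Q ω ^ 2 + 4 * (X ω * (Q ω * S ω)) + 2 * b * ((X ω ^ 2 - 1) * Q ω)
      + 4 * (X ω ^ 2 * S ω ^ 2)) P :=
    k2.add (j3.const_mul 4)
  have k4 : Integrable (fun ω => Q ω ^ 2 + 4 * (X ω * (Q ω * S ω)) + 2 * b * ((X ω ^ 2 - 1) * Q ω)
      + 4 * (X ω ^ 2 * S ω ^ 2) + 4 * b * ((X ω ^ 3 - X ω) * S ω)) P :=
    k3.add (j4.const_mul (4 * b))
  have k5 : Integrable (fun ω => Q ω ^ 2 + 4 * (X ω * (Q ω * S ω)) + 2 * b * ((X ω ^ 2 - 1) * Q ω)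
      + 4 * (X ω ^ 2 * S ω ^ 2) + 4 * b * ((X ω ^ 3 - X ω) * S ω) + b ^ 2 * (X ω ^ 2 - 1) ^ 2) P :=
    k4.add (j6.const_mul (b ^ 2))
  have l1 : Integrable (fun ω => Q ω + 2 * (X ω * S ω)) P := iQ.add (j5.const_mul 2)
  refine ⟨?_, ?_, ?_⟩
  · rw [memLp_two_iff_integrable_sq]
    · exact k5.congr (ae_of_all _ fun ω => (hexp ω).symm)
    · refine (l1.add (iX2.const_mul b)).1.congr (ae_of_all _ fun ω => ?_)
      simp only [Pi.add_apply]
      ring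
  · simp only [mul_assoc]
    rw [integral_add l1 (iX2.const_mul b), integral_add iQ (j5.const_mul 2), integral_const_mul,
      integral_const_mul, e5, e2', hQ0]
    simp
  · simp only [hexp]
    rw [integral_add k4 (j6.const_mul (b ^ 2)), integral_add k3 (j4.const_mul (4 * b)),
      integral_add k2 (j3.const_mul 4), integral_add k1 (j2.const_mul (2 * b)),
      integral_add iQQ (j1.const_mul 4)]
    simp only [integral_const_mul, e1, e2, e3, e4]
    nlinarith [mul_le_mul_of_nonneg_right e6 (sq_nonneg b)]

variable {ι : Type*} {W : ι → Ω → ℝ} {M : ℝ}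

theorem IndepStandardized.memLp_two (h : IndepStandardized W P M) (i : ι) : MemLp (W i) 2 P := by
  rw [memLp_two_iff_integrable_sq (h.aemeasurable i).aestronglyMeasurable]
  exact integrable_pow_of_pow_four (h.aemeasurable i) (h.integrable_four i) (by norm_num)

theorem IndepStandardized.memLp_linear (h : IndepStandardized W P M) (s : Finset ι) (c : ι → ℝ) :
    MemLp (fun ω => ∑ j ∈ s, c j * W j ω) 2 P :=
  memLp_finsetSum s fun j _ => (h.memLp_two j).const_mul (c j)

theorem IndepStandardized.integral_linear (h : IndepStandardized W P M) (s : Finset ι)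
    (c : ι → ℝ) : ∫ ω, ∑ j ∈ s, c j * W j ω ∂P = 0 := by
  rw [integral_finsetSum _ fun j _ =>
    ((h.memLp_two j).integrable (by norm_num)).const_mul (c j)]
  simp [integral_const_mul, h.mean_zero]

theorem IndepStandardized.integral_linear_sq (h : IndepStandardized W P M) (s : Finset ι)
    (c : ι → ℝ) : ∫ ω, (∑ j ∈ s, c j * W j ω) ^ 2 ∂P = ∑ j ∈ s, c j ^ 2 := by
  rw [← variance_of_integral_eq_zero (h.memLp_linear s c).aemeasurable (h.integral_linear s c)]
  have hv := IndepFun.variance_sum (μ := P) (X := fun j ω => c j * W j ω) (s := s)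
    (fun j _ => (h.memLp_two j).const_mul (c j))
    (fun i _ j _ hij => (h.indep.indepFun hij).comp (φ := fun x => c i * x)
      (ψ := fun x => c j * x) (by fun_prop) (by fun_prop))
  have hsum : (fun ω => ∑ j ∈ s, c j * W j ω) = ∑ j ∈ s, fun ω => c j * W j ω := by
    ext ω; simp
  rw [hsum, hv]
  refine Finset.sum_congr rfl fun j _ => ?_
  rw [variance_const_mul, variance_of_integral_eq_zero (h.aemeasurable j) (h.mean_zero j),
    h.sq_one j, mul_one]

/-- The variance of a quadratic form in independent standardized variables is at most a constant
times the squared Frobenius norm of its matrix. The coordinates are added one at a time. -/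
theorem IndepStandardized.integral_quadratic_sq_le [DecidableEq ι] (h : IndepStandardized W P M)
    (A : ι → ι → ℝ) (hA : ∀ i j, A i j = A j i) (s : Finset ι) :
    MemLp (fun ω => ∑ i ∈ s, ∑ j ∈ s, A i j * (W i ω * W j ω) - ∑ i ∈ s, A i i) 2 P ∧
    ∫ ω, (∑ i ∈ s, ∑ j ∈ s, A i j * (W i ω * W j ω) - ∑ i ∈ s, A i i) ∂P = 0 ∧
    ∫ ω, (∑ i ∈ s, ∑ j ∈ s, A i j * (W i ω * W j ω) - ∑ i ∈ s, A i i) ^ 2 ∂P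
      ≤ (M + 2) * ∑ i ∈ s, ∑ j ∈ s, A i j ^ 2 := by
  induction s using Finset.induction_on with
  | empty => simp
  | insert a s ha ih =>
    obtain ⟨ih1, ih2, ih3⟩ := ih
    set Q : Ω → ℝ := fun ω => ∑ i ∈ s, ∑ j ∈ s, A i j * (W i ω * W j ω) - ∑ i ∈ s, A i i with hQ
    set S : Ω → ℝ := fun ω => ∑ j ∈ s, A a j * W j ω with hS
    have hind : IndepFun (W a) (fun ω => (Q ω, S ω)) P := by
      have h0 := h.indep.indepFun_finset₀ {a} s (by simpa using ha) h.aemeasurable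
      refine h0.comp (φ := fun x : ({a} : Finset ι) → ℝ => x ⟨a, by simp⟩)
        (ψ := fun x : s → ℝ => (∑ i : s, ∑ j : s, A i j * (x i * x j) - ∑ i ∈ s, A i i,
          ∑ j : s, A a j * x j)) (by fun_prop) (by fun_prop) |>.congr (ae_of_all _ fun ω => rfl) ?_
      refine ae_of_all _ fun ω => ?_
      simp only [Function.comp, hQ, hS]
      congr 1
      · congr 1
        rw [← Finset.sum_coe_sort s]
        refine Finset.sum_congr rfl fun i _ => ?_
        rw [← Finset.sum_coe_sort s]
      · rw [← Finset.sum_coe_sort s]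
    have key := integral_sq_add_step (A a a) (h.aemeasurable a) (h.integrable_four a)
      (h.mean_zero a) (h.sq_one a) (h.four_le a) ih1 (h.memLp_linear s (A a)) ih2
      (h.integral_linear s (A a)) hind
    have hrec : ∀ ω, ∑ i ∈ insert a s, ∑ j ∈ insert a s, A i j * (W i ω * W j ω)
          - ∑ i ∈ insert a s, A i i
        = Q ω + 2 * W a ω * S ω + A a a * (W a ω ^ 2 - 1) := by
      intro ω
      simp only [Finset.sum_insert ha, Finset.sum_add_distrib, hQ, hS]
      have e1 : ∑ i ∈ s, A i a * (W i ω * W a ω) = W a ω * ∑ j ∈ s, A a j * W j ω := by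
        rw [Finset.mul_sum]
        exact Finset.sum_congr rfl fun i _ => by rw [hA i a]; ring
      have e2 : ∑ i ∈ s, A a i * (W a ω * W i ω) = W a ω * ∑ j ∈ s, A a j * W j ω := by
        rw [Finset.mul_sum]
        exact Finset.sum_congr rfl fun i _ => by ring
      rw [e1, e2]
      ring
    simp only [hrec]
    refine ⟨key.1, key.2.1, key.2.2.trans ?_⟩
    rw [h.integral_linear_sq s (A a)]
    have e3 : ∑ i ∈ insert a s, ∑ j ∈ insert a s, A i j ^ 2
        = ∑ i ∈ s, ∑ j ∈ s, A i j ^ 2 + 2 * ∑ j ∈ s, A a j ^ 2 + A a a ^ 2 := by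
      simp only [Finset.sum_insert ha, Finset.sum_add_distrib]
      have : ∑ i ∈ s, A i a ^ 2 = ∑ j ∈ s, A a j ^ 2 :=
        Finset.sum_congr rfl fun i _ => by rw [hA i a]
      rw [this]
      ring
    have hM : 0 ≤ M := (integral_nonneg fun ω => by positivity).trans (h.four_le a)
    have hpos : 0 ≤ ∑ j ∈ s, A a j ^ 2 := Finset.sum_nonneg fun j _ => sq_nonneg _
    rw [e3]
    nlinarith [mul_nonneg hM hpos, sq_nonneg (A a a)]

end Forms

/-! ### Characteristic functions of linear forms -/

/-- Products of factors in the unit disc differ by at most the sum of the differences. -/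
theorem norm_prod_sub_prod_le {ι : Type*} (s : Finset ι) (f g : ι → ℂ)
    (hf : ∀ i ∈ s, ‖f i‖ ≤ 1) (hg : ∀ i ∈ s, ‖g i‖ ≤ 1) :
    ‖∏ i ∈ s, f i - ∏ i ∈ s, g i‖ ≤ ∑ i ∈ s, ‖f i - g i‖ := by
  classical
  induction s using Finset.induction_on with
  | empty => simp
  | insert a s ha ih =>
    have ih' := ih (fun i hi => hf i (Finset.mem_insert_of_mem hi))
      (fun i hi => hg i (Finset.mem_insert_of_mem hi))
    rw [Finset.prod_insert ha, Finset.prod_insert ha, Finset.sum_insert ha]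
    have hp : ‖∏ i ∈ s, f i‖ ≤ 1 := by
      rw [norm_prod]
      exact Finset.prod_le_one (fun _ _ => norm_nonneg _)
        fun i hi => hf i (Finset.mem_insert_of_mem hi)
    have hga := hg a (Finset.mem_insert_self _ _)
    calc ‖f a * ∏ i ∈ s, f i - g a * ∏ i ∈ s, g i‖
        = ‖(f a - g a) * ∏ i ∈ s, f i + g a * (∏ i ∈ s, f i - ∏ i ∈ s, g i)‖ := by
          congr 1; ring
      _ ≤ ‖f a - g a‖ * ‖∏ i ∈ s, f i‖ + ‖g a‖ * ‖∏ i ∈ s, f i - ∏ i ∈ s, g i‖ := by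
          refine (norm_add_le _ _).trans ?_
          rw [norm_mul, norm_mul]
      _ ≤ ‖f a - g a‖ * 1 + 1 * ∑ i ∈ s, ‖f i - g i‖ := by gcongr
      _ = _ := by ring

theorem norm_exp_mul_I_sub_taylor_le (x : ℝ) :
    ‖Complex.exp (x * Complex.I) - (1 + x * Complex.I - x ^ 2 / 2)‖ ≤ 4 * |x| ^ 3 := by
  rcases le_total |x| 1 with h | h
  · have hn : ‖(x : ℂ) * Complex.I‖ = |x| := by simp
    have h3 := Complex.exp_bound (x := (x : ℂ) * Complex.I) (by rw [hn]; exact h) (n := 3)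
      (by norm_num)
    rw [hn] at h3
    have he : ∑ m ∈ Finset.range 3, ((x : ℂ) * Complex.I) ^ m / (m.factorial : ℂ)
        = 1 + x * Complex.I - x ^ 2 / 2 := by
      simp [Finset.sum_range_succ, Nat.factorial, mul_pow]
      ring
    rw [he] at h3
    refine h3.trans ?_
    have : 0 ≤ |x| ^ 3 := by positivity
    norm_num [Nat.factorial]
    linarith
  · have h1 : ‖Complex.exp (x * Complex.I)‖ = 1 := Complex.norm_exp_ofReal_mul_I x
    have h2 : ‖(1 + x * Complex.I - x ^ 2 / 2 : ℂ)‖ ≤ 1 + |x| + |x| ^ 2 / 2 := by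
      refine (norm_sub_le _ _).trans (add_le_add ((norm_add_le _ _).trans ?_) ?_)
      · simp
      · simp
    refine (norm_sub_le _ _).trans ?_
    rw [h1]
    have h3 : |x| ≤ |x| ^ 3 := le_self_pow₀ h (by norm_num)
    have h4 : |x| ^ 2 ≤ |x| ^ 3 := pow_le_pow_right₀ h (by norm_num)
    linarith

section

variable {Ω : Type*} [MeasurableSpace Ω] {P : Measure Ω} [IsProbabilityMeasure P]

/-- Second-order expansion of a characteristic function, with an explicit third-order remainder that
is uniform over variables with the same fourth moment bound. -/
theorem norm_charFun_sub_taylor_le {X : Ω → ℝ} {M : ℝ} (hX : AEMeasurable X P)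
    (hX4 : Integrable (fun ω => X ω ^ 4) P) (h1 : ∫ ω, X ω ∂P = 0)
    (h2 : ∫ ω, X ω ^ 2 ∂P = 1) (h4 : ∫ ω, X ω ^ 4 ∂P ≤ M) (c : ℝ) :
    ‖charFun (P.map X) c - (1 - (c : ℂ) ^ 2 / 2)‖ ≤ 4 * (1 + M) * |c| ^ 3 := by
  have i1 : Integrable X P := by
    simpa using integrable_pow_of_pow_four hX hX4 (k := 1) (by norm_num)
  have i2 := integrable_pow_of_pow_four hX hX4 (k := 2) (by norm_num)
  have ie : Integrable (fun ω => Complex.exp (((c * X ω : ℝ) : ℂ) * Complex.I)) P := by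
    refine Integrable.of_bound (C := 1) ?_ (ae_of_all _ fun ω => ?_)
    · exact (by fun_prop : AEMeasurable _ P).aestronglyMeasurable
    · exact (Complex.norm_exp_ofReal_mul_I _).le
  have j1 : Integrable (fun ω => ((c * X ω : ℝ) : ℂ) * Complex.I) P :=
    (i1.const_mul c).ofReal.mul_const _
  have j2 : Integrable (fun ω => ((c * X ω : ℝ) : ℂ) ^ 2 / 2) P := by
    have := ((i2.const_mul (c ^ 2)).ofReal (𝕜 := ℂ)).div_const 2
    refine this.congr (ae_of_all _ fun ω => ?_)
    push_cast
    simp [mul_pow]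
  have j3 : Integrable (fun ω => (1 + ((c * X ω : ℝ) : ℂ) * Complex.I)) P :=
    (integrable_const 1).add j1
  have j4 : Integrable (fun ω => (1 + ((c * X ω : ℝ) : ℂ) * Complex.I
      - ((c * X ω : ℝ) : ℂ) ^ 2 / 2)) P := j3.sub j2
  have e1 : charFun (P.map X) c
      = ∫ ω, Complex.exp (((c * X ω : ℝ) : ℂ) * Complex.I) ∂P := by
    rw [charFun_apply_real, integral_map hX (by fun_prop)]
    push_cast
    rfl
  have e2 : ∫ ω, (1 + ((c * X ω : ℝ) : ℂ) * Complex.I - ((c * X ω : ℝ) : ℂ) ^ 2 / 2) ∂P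
      = 1 - (c : ℂ) ^ 2 / 2 := by
    have s1 : ∫ ω, ((c * X ω : ℝ) : ℂ) * Complex.I ∂P = 0 := by
      rw [integral_mul_const, integral_complex_ofReal, integral_const_mul, h1]; simp
    have s2 : ∫ ω, ((c * X ω : ℝ) : ℂ) ^ 2 / 2 ∂P = (c : ℂ) ^ 2 / 2 := by
      have : ∀ ω, ((c * X ω : ℝ) : ℂ) ^ 2 / 2 = ((c ^ 2 / 2 * X ω ^ 2 : ℝ) : ℂ) := by
        intro ω; push_cast; ring
      simp only [this]
      rw [integral_complex_ofReal, integral_const_mul, h2]; simp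
    rw [integral_sub j3 j2, integral_add (integrable_const 1) j1, s1, s2]
    simp
  rw [e1, ← e2, ← integral_sub ie j4]
  refine (norm_integral_le_integral_norm _).trans ?_
  have jb : Integrable (fun ω => 4 * |c| ^ 3 * (1 + X ω ^ 4)) P :=
    ((integrable_const 1).add hX4).const_mul _
  refine (integral_mono (ie.sub j4).norm jb fun ω => ?_).trans ?_
  · refine (norm_exp_mul_I_sub_taylor_le (c * X ω)).trans ?_
    rw [abs_mul, mul_pow, ← mul_assoc]
    gcongr
    have h4 : X ω ^ 4 = |X ω| ^ 4 := (Even.pow_abs ⟨2, rfl⟩ _).symm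
    rw [h4]
    rcases le_total |X ω| 1 with h | h
    · have := pow_le_one₀ (n := 3) (abs_nonneg _) h
      have : 0 ≤ |X ω| ^ 4 := by positivity
      linarith
    · have := pow_le_pow_right₀ h (show 3 ≤ 4 by norm_num)
      linarith
  · rw [integral_const_mul, integral_add (integrable_const 1) hX4]
    have : 0 ≤ |c| ^ 3 := by positivity
    simp only [integral_const, probReal_univ, smul_eq_mul, mul_one]
    nlinarith

theorem norm_charFun_sub_gaussian_le {X : Ω → ℝ} {M : ℝ} (hX : AEMeasurable X P)
    (hX4 : Integrable (fun ω => X ω ^ 4) P) (h1 : ∫ ω, X ω ∂P = 0)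
    (h2 : ∫ ω, X ω ^ 2 ∂P = 1) (h4 : ∫ ω, X ω ^ 4 ∂P ≤ M) {c : ℝ} (hc : |c| ≤ 1) :
    ‖charFun (P.map X) c - Complex.exp (-(c : ℂ) ^ 2 / 2)‖ ≤ (4 * (1 + M) + 1) * |c| ^ 3 := by
  have hsq : c ^ 2 ≤ 1 := by
    rw [← sq_abs]; exact pow_le_one₀ (abs_nonneg _) hc
  have hg : ‖(1 - (c : ℂ) ^ 2 / 2) - Complex.exp (-(c : ℂ) ^ 2 / 2)‖ ≤ |c| ^ 3 := by
    have h := Real.abs_exp_sub_one_sub_id_le (x := -c ^ 2 / 2)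
      (by rw [abs_le]; constructor <;> nlinarith)
    have e : (1 - (c : ℂ) ^ 2 / 2) - Complex.exp (-(c : ℂ) ^ 2 / 2)
        = ((-(Real.exp (-c ^ 2 / 2) - 1 - -c ^ 2 / 2) : ℝ) : ℂ) := by
      push_cast; ring
    rw [e, Complex.norm_real, Real.norm_eq_abs, abs_neg]
    refine h.trans ?_
    have h5 : (-c ^ 2 / 2) ^ 2 = |c| ^ 4 / 4 := by
      rw [Even.pow_abs ⟨2, rfl⟩]; ring
    have h6 : |c| ^ 4 ≤ |c| ^ 3 := pow_le_pow_of_le_one (abs_nonneg _) hc (by norm_num)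
    have h7 : 0 ≤ |c| ^ 3 := by positivity
    rw [h5]; linarith
  calc _ ≤ ‖charFun (P.map X) c - (1 - (c : ℂ) ^ 2 / 2)‖
        + ‖(1 - (c : ℂ) ^ 2 / 2) - Complex.exp (-(c : ℂ) ^ 2 / 2)‖ :=
        norm_sub_le_norm_sub_add_norm_sub _ _ _
    _ ≤ 4 * (1 + M) * |c| ^ 3 + |c| ^ 3 :=
        add_le_add (norm_charFun_sub_taylor_le hX hX4 h1 h2 h4 c) hg
    _ = _ := by ring

/-- Quantitative central limit theorem: a linear form whose coefficients are all at most `m` is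
close to a centred Gaussian variable, in terms of characteristic functions. -/
theorem IndepStandardized.norm_charFun_linear_sub_le {ι : Type*} [Fintype ι] {W : ι → Ω → ℝ} {M : ℝ}
    (h : IndepStandardized W P M) (c : ι → ℝ) {m : ℝ} (hm : ∀ i, |c i| ≤ m) (hm1 : m ≤ 1) :
    ‖charFun (P.map fun ω => ∑ i, c i * W i ω) 1 - Complex.exp (-((∑ i, c i ^ 2 : ℝ) : ℂ) / 2)‖
      ≤ (4 * (1 + M) + 1) * m * ∑ i, c i ^ 2 := by
  have hind : iIndepFun (fun i ω => c i * W i ω) P :=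
    h.indep.comp (fun i x => c i * x) fun i => by fun_prop
  have e1 : charFun (P.map fun ω => ∑ i, c i * W i ω) 1 = ∏ i, charFun (P.map (W i)) (c i) := by
    rw [hind.charFun_map_fun_sum_eq_prod fun i => (h.aemeasurable i).const_mul (c i),
      Finset.prod_apply]
    refine Finset.prod_congr rfl fun i _ => ?_
    rw [charFun_map_mul_comp (h.aemeasurable i), mul_one]
  have e2 : Complex.exp (-((∑ i, c i ^ 2 : ℝ) : ℂ) / 2)
      = ∏ i, Complex.exp (-(c i : ℂ) ^ 2 / 2) := by
    rw [← Complex.exp_sum]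
    congr 1
    push_cast
    rw [← Finset.sum_div, Finset.sum_neg_distrib]
  rw [e1, e2]
  refine (norm_prod_sub_prod_le _ _ _ (fun i _ => ?_) (fun i _ => ?_)).trans ?_
  · have := Measure.isProbabilityMeasure_map (h.aemeasurable i)
    exact norm_charFun_le_one _
  · have : -(c i : ℂ) ^ 2 / 2 = ((-(c i ^ 2) / 2 : ℝ) : ℂ) := by push_cast; ring
    rw [this, ← Complex.ofReal_exp, Complex.norm_real, Real.norm_eq_abs, Real.abs_exp,
      Real.exp_le_one_iff]
    nlinarith [sq_nonneg (c i)]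
  · rw [Finset.mul_sum]
    refine Finset.sum_le_sum fun i _ => ?_
    refine (norm_charFun_sub_gaussian_le (h.aemeasurable i) (h.integrable_four i)
      (h.mean_zero i) (h.sq_one i) (h.four_le i) ((hm i).trans hm1)).trans ?_
    have hM : 0 ≤ M := (integral_nonneg fun ω => by positivity).trans (h.four_le i)
    rw [mul_assoc]
    gcongr
    rw [pow_succ', sq_abs]
    exact mul_le_mul_of_nonneg_right (hm i) (sq_nonneg _)

theorem integral_abs_le_sqrt_integral_sq {X : Ω → ℝ} (hX : MemLp X 2 P) :
    ∫ ω, |X ω| ∂P ≤ √(∫ ω, X ω ^ 2 ∂P) := by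
  have h := variance_nonneg |X| P
  rw [variance_eq_sub hX.abs] at h
  refine Real.le_sqrt_of_sq_le ?_
  simp only [Pi.pow_apply, Pi.abs_apply, sq_abs] at h
  linarith

theorem norm_charFun_map_sub_le {X Y : Ω → ℝ} (hX : AEMeasurable X P) (hY : AEMeasurable Y P)
    (hXY : MemLp (fun ω => Y ω - X ω) 2 P) (t : ℝ) :
    ‖charFun (P.map Y) t - charFun (P.map X) t‖ ≤ |t| * √(∫ ω, (Y ω - X ω) ^ 2 ∂P) := by
  have ie : ∀ {U : Ω → ℝ}, AEMeasurable U P →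
      Integrable (fun ω => Complex.exp (t * U ω * Complex.I)) P := by
    intro U hU
    refine Integrable.of_bound (C := 1) ?_ (ae_of_all _ fun ω => ?_)
    · exact (by fun_prop : AEMeasurable _ P).aestronglyMeasurable
    · have := Complex.norm_exp_ofReal_mul_I (t * U ω)
      push_cast at this
      exact this.le
  rw [charFun_apply_real, charFun_apply_real, integral_map hY (by fun_prop),
    integral_map hX (by fun_prop), ← integral_sub (ie hY) (ie hX)]
  refine (norm_integral_le_integral_norm _).trans ?_
  have hint : Integrable (fun ω => |Y ω - X ω|) P := (hXY.integrable (by norm_num)).abs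
  refine (integral_mono ((ie hY).sub (ie hX)).norm (hint.const_mul |t|) fun ω => ?_).trans ?_
  · have e : Complex.exp (t * Y ω * Complex.I) - Complex.exp (t * X ω * Complex.I)
        = Complex.exp (((t * X ω : ℝ) : ℂ) * Complex.I)
          * (Complex.exp (Complex.I * ((t * (Y ω - X ω) : ℝ) : ℂ)) - 1) := by
      rw [mul_sub, ← Complex.exp_add, mul_one]
      push_cast
      ring_nf
    simp only [Pi.sub_apply]
    rw [e, norm_mul, Complex.norm_exp_ofReal_mul_I, one_mul]
    refine (Real.norm_exp_I_mul_ofReal_sub_one_le).trans ?_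
    rw [Real.norm_eq_abs, abs_mul]
  · rw [integral_const_mul]
    gcongr
    exact integral_abs_le_sqrt_integral_sq hXY

end

/-- Convergence in distribution is not affected by a perturbation that tends to zero in `L²`, even
if the probability space changes along the sequence. -/
theorem tendstoInDistribution_of_integral_sub_sq {Ω : ℕ → Type*} [∀ n, MeasurableSpace (Ω n)]
    {P : ∀ n, Measure (Ω n)} [∀ n, IsProbabilityMeasure (P n)] {Ω' : Type*} [MeasurableSpace Ω']
    {P' : Measure Ω'} [IsProbabilityMeasure P'] {X Y : ∀ n, Ω n → ℝ} {Z : Ω' → ℝ}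
    (hX : TendstoInDistribution X atTop Z P P') (hY : ∀ n, AEMeasurable (Y n) (P n))
    (hmem : ∀ᶠ n in atTop, MemLp (fun ω => Y n ω - X n ω) 2 (P n))
    (hlim : Tendsto (fun n => ∫ ω, (Y n ω - X n ω) ^ 2 ∂P n) atTop (𝓝 0)) :
    TendstoInDistribution Y atTop Z P P' where
  forall_aemeasurable := hY
  aemeasurable_limit := hX.aemeasurable_limit
  tendsto := by
    refine ProbabilityMeasure.tendsto_iff_tendsto_charFun.2 fun t => ?_
    have h1 := ProbabilityMeasure.tendsto_iff_tendsto_charFun.1 hX.tendsto t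
    have h2 : Tendsto (fun n => charFun ((P n).map (Y n)) t - charFun ((P n).map (X n)) t)
        atTop (𝓝 0) := by
      refine squeeze_zero_norm' (a := fun n => |t| * √(∫ ω, (Y n ω - X n ω) ^ 2 ∂P n)) ?_ ?_
      · filter_upwards [hmem] with n hn
        exact norm_charFun_map_sub_le (hX.forall_aemeasurable n) (hY n) hn t
      · simpa using (hlim.sqrt).const_mul |t|
    simpa using h1.add h2

/-! ### Spectral decomposition -/

section Spectral

variable {n : ℕ}

/-- Spectral theorem with the eigenvalues in decreasing order. -/
theorem exists_spectral_decomposition {V : Matrix (Fin n) (Fin n) ℝ} (hV : V.IsHermitian) :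
    ∃ b : Fin n → Fin n → ℝ,
      (∀ k l, ∑ i, b k i * b l i = if k = l then 1 else 0) ∧
      ∀ i j, V i j = ∑ k : Fin n, eigval hV k * (b k i * b k j) := by
  -- `eigenvalues` is a reindexing of the ordered `eigenvalues₀`, and `e` undoes it.
  let e : Fin n ≃ Fin n := (finCongr (Fintype.card_fin n).symm).trans
    (Fintype.equivOfCardEq (Fintype.card_fin _))
  have hev : ∀ k : Fin n, eigval hV k = hV.eigenvalues (e k) := by
    intro k
    simp [eigval, e, Matrix.IsHermitian.eigenvalues]
    rfl
  refine ⟨fun k i => hV.eigenvectorBasis (e k) i, fun k l => ?_, fun i j => ?_⟩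
  · have h := (orthonormal_iff_ite.1 hV.eigenvectorBasis.orthonormal) (e k) (e l)
    simp only [e.injective.eq_iff] at h
    rw [← h, PiLp.inner_apply]
    refine Finset.sum_congr rfl fun i _ => ?_
    simp [mul_comm]
  · have h := congrFun (congrFun hV.spectral_theorem i) j
    rw [Unitary.conjStarAlgAut_apply, Matrix.mul_apply] at h
    rw [h, ← e.sum_comp]
    refine Finset.sum_congr rfl fun k _ => ?_
    rw [Matrix.mul_diagonal, hev]
    simp
    ring

theorem eigval_antitone {V : Matrix (Fin n) (Fin n) ℝ} (hV : V.PosSemidef) :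
    Antitone (eigval hV.1) := by
  intro i j hij
  unfold eigval
  split_ifs with h1 h2 h2
  · exact hV.1.eigenvalues₀_antitone hij
  · omega
  · have := hV.eigenvalues_nonneg (Fintype.equivOfCardEq (Fintype.card_fin _)
      (⟨i, by simpa using h2⟩ : Fin (Fintype.card (Fin n))))
    simpa [Matrix.IsHermitian.eigenvalues] using this
  · rfl

theorem eigval_nonneg {V : Matrix (Fin n) (Fin n) ℝ} (hV : V.PosSemidef) (i : ℕ) :
    0 ≤ eigval hV.1 i := by
  -- Beyond the dimension, `eigval` takes its conventional value zero.
  have h : eigval hV.1 (max i n) = 0 := by simp [eigval]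
  exact h.symm.le.trans (eigval_antitone hV (le_max_left i n))

variable {b : Fin n → Fin n → ℝ}

/-- The trace of `∑ₖ dₖ bₖ bₖᵀ`. -/
theorem sum_diag_of_orthonormal (hb : ∀ k l, ∑ i, b k i * b l i = if k = l then 1 else 0)
    (d : Fin n → ℝ) : ∑ i, ∑ k, d k * (b k i * b k i) = ∑ k, d k := by
  rw [Finset.sum_comm]
  refine Finset.sum_congr rfl fun k _ => ?_
  rw [← Finset.mul_sum, hb]
  simp

/-- The squared Frobenius norm of `∑ₖ dₖ bₖ bₖᵀ`. -/
theorem sum_sq_of_orthonormal (hb : ∀ k l, ∑ i, b k i * b l i = if k = l then 1 else 0)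
    (d : Fin n → ℝ) : ∑ i, ∑ j, (∑ k, d k * (b k i * b k j)) ^ 2 = ∑ k, d k ^ 2 := by
  calc ∑ i, ∑ j, (∑ k, d k * (b k i * b k j)) ^ 2
      = ∑ i, ∑ j, ∑ k, ∑ l, d k * d l * ((b k i * b l i) * (b k j * b l j)) := by
        refine Finset.sum_congr rfl fun i _ => Finset.sum_congr rfl fun j _ => ?_
        rw [sq, Finset.sum_mul_sum]
        refine Finset.sum_congr rfl fun k _ => Finset.sum_congr rfl fun l _ => ?_
        ring
    _ = ∑ k, ∑ l, ∑ i, ∑ j, d k * d l * ((b k i * b l i) * (b k j * b l j)) := by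
        rw [Finset.sum_congr rfl fun i _ => Finset.sum_comm, Finset.sum_comm]
        refine Finset.sum_congr rfl fun k _ => ?_
        rw [Finset.sum_congr rfl fun i _ => Finset.sum_comm, Finset.sum_comm]
    _ = ∑ k, ∑ l, d k * d l * ((∑ i, b k i * b l i) * ∑ j, b k j * b l j) := by
        refine Finset.sum_congr rfl fun k _ => Finset.sum_congr rfl fun l _ => ?_
        rw [Finset.sum_mul_sum, Finset.mul_sum]
        exact Finset.sum_congr rfl fun i _ => by rw [Finset.mul_sum]
    _ = ∑ k, d k ^ 2 := by
        simp [hb, sq]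

theorem sum_mul_of_spectral (d x : Fin n → ℝ) :
    ∑ i, ∑ j, (∑ k, d k * (b k i * b k j)) * (x i * x j)
      = ∑ k, d k * (∑ i, b k i * x i) ^ 2 := by
  simp only [sq, Finset.mul_sum, Finset.sum_mul]
  rw [Finset.sum_congr rfl fun i _ => Finset.sum_comm, Finset.sum_comm]
  refine Finset.sum_congr rfl fun k _ => ?_
  rw [Finset.sum_comm]
  exact Finset.sum_congr rfl fun i _ => Finset.sum_congr rfl fun j _ => by ring

end Spectral

/-! ### The matrix `V` -/

section ErrV

variable {Ω : Type*} [MeasurableSpace Ω] {n : ℕ} {ε w : Ω → Fin n → ℝ} {P : Measure Ω} {Kw : ℝ}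

theorem errV_diag (h : ∀ i, AEMeasurable (fun ω => ε ω i) P) (i : Fin n) :
    errV ε P i i = (avgVar ε P)⁻¹ * variance (fun ω => ε ω i) P := by
  simp [errV, covariance_self (h i)]

theorem SubGaussianErrors.aemeasurable_eps (h : SubGaussianErrors ε w P Kw) (i : Fin n) :
    AEMeasurable (fun ω => ε ω i) P := by
  have hw := h.aemeasurable
  have : AEMeasurable (fun ω => (Real.sqrt (avgVar ε P) • (matSqrt (errV ε P) *ᵥ w ω)) i) P := by
    simp only [Pi.smul_apply, Matrix.mulVec, dotProduct, smul_eq_mul]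
    fun_prop
  refine this.congr ?_
  filter_upwards [h.eps_eq] with ω hω
  rw [hω]

theorem SubGaussianErrors.avgVar_ne_zero (h : SubGaussianErrors ε w P Kw) (hn : 0 < n) :
    avgVar ε P ≠ 0 := by
  intro h1
  have h2 := h.posDef.diag_pos (i := ⟨0, hn⟩)
  simp [errV, h1] at h2

/-- The eigenvalues sum to `tr V = n`, since `V` is normalized by the average variance. -/
theorem SubGaussianErrors.sum_eigval (h : SubGaussianErrors ε w P Kw) (hn : 0 < n) :
    ∑ k : Fin n, eigval (errV_isHermitian ε P) k = n := by
  obtain ⟨b, hb, hV⟩ := exists_spectral_decomposition (errV_isHermitian ε P)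
  rw [← sum_diag_of_orthonormal hb]
  have hne := h.avgVar_ne_zero hn
  have hn' : (n : ℝ) ≠ 0 := by positivity
  calc _ = ∑ i, (avgVar ε P)⁻¹ * variance (fun ω => ε ω i) P := by
        refine Finset.sum_congr rfl fun i _ => ?_
        rw [← hV, errV_diag h.aemeasurable_eps]
    _ = (avgVar ε P)⁻¹ * (n * avgVar ε P) := by
        rw [← Finset.mul_sum, avgVar]
        field_simp
    _ = n := by field_simp

theorem SubGaussianErrors.errV_diag_le (h : SubGaussianErrors ε w P Kw) {Vlo Vup : ℝ}
    (hlo : 0 < Vlo) (hvar : ∀ i, variance (fun ω => ε ω i) P ∈ Set.Icc Vlo Vup) (i : Fin n) :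
    errV ε P i i ≤ Vup / Vlo := by
  have hn : 0 < n := i.pos
  have hn' : (0 : ℝ) < n := by positivity
  have havg : Vlo ≤ avgVar ε P := by
    rw [avgVar, le_div_iff₀ hn']
    calc Vlo * n = ∑ _i : Fin n, Vlo := by simp [mul_comm]
      _ ≤ _ := Finset.sum_le_sum fun i _ => (hvar i).1
  rw [errV_diag h.aemeasurable_eps, inv_mul_eq_div]
  have h1 := (hvar i).2
  have h2 := variance_nonneg (fun ω => ε ω i) P
  exact div_le_div₀ (h2.trans h1) h1 hlo havg

end ErrV

/-! ### Joint asymptotic normality of delocalized projections -/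

/-- The multivariate central limit theorem for projections on finitely many orthonormal vectors
whose entries tend to zero uniformly. -/
theorem tendstoInDistribution_projections {Ω : ℕ → Type*} [∀ n, MeasurableSpace (Ω n)]
    {P : ∀ n, Measure (Ω n)} [∀ n, IsProbabilityMeasure (P n)]
    {w : ∀ n, Ω n → Fin n → ℝ} {M : ℝ}
    (hw : ∀ n, IndepStandardized (fun i ω => w n ω i) (P n) M) {K : ℕ}
    (U : ∀ n, Fin K → Fin n → ℝ)
    (hU : ∀ᶠ n in atTop, ∀ k l, ∑ i, U n k i * U n l i = if k = l then 1 else 0)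
    {r : ℕ → ℝ} (hr : Tendsto r atTop (𝓝 0)) (hUr : ∀ᶠ n in atTop, ∀ k i, |U n k i| ≤ r n)
    {Ω' : Type*} [MeasurableSpace Ω'] {P' : Measure Ω'} [IsProbabilityMeasure P']
    {Z : Fin K → Ω' → ℝ} (hZ : iIndepFun Z P') (hZg : ∀ i, HasLaw (Z i) (gaussianReal 0 1) P') :
    TendstoInDistribution
      (fun n ω => (WithLp.toLp 2 fun k => ∑ i, U n k i * w n ω i : EuclideanSpace ℝ (Fin K)))
      atTop (fun ω' => WithLp.toLp 2 fun k => Z k ω') P P' := by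
  have hwm : ∀ n i, AEMeasurable (fun ω => w n ω i) (P n) := fun n => (hw n).aemeasurable
  have hZm : ∀ k, AEMeasurable (Z k) P' := fun k => (hZg k).aemeasurable
  have hXm : ∀ n, AEMeasurable
      (fun ω => (WithLp.toLp 2 fun k => ∑ i, U n k i * w n ω i : EuclideanSpace ℝ (Fin K)))
      (P n) := by
    intro n
    have : AEMeasurable (fun ω => fun k => ∑ i, U n k i * w n ω i) (P n) :=
      aemeasurable_pi_lambda _ fun k =>
        Finset.aemeasurable_fun_sum _ fun i _ => (hwm n i).const_mul _
    fun_prop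
  refine ⟨hXm, by fun_prop, ?_⟩
  refine ProbabilityMeasure.tendsto_iff_tendsto_charFun.2 fun t => ?_
  have hlim : charFun
        (P'.map fun ω' => (WithLp.toLp 2 fun k => Z k ω' : EuclideanSpace ℝ (Fin K))) t
      = Complex.exp (-((∑ k, t k ^ 2 : ℝ) : ℂ) / 2) := by
    rw [(iIndepFun_iff_charFun_pi hZm).1 hZ t]
    have : ∀ k, charFun (P'.map (Z k)) (t k) = Complex.exp (-((t k : ℂ)) ^ 2 / 2) := by
      intro k
      rw [(hZg k).map_eq, charFun_gaussianReal]
      congr 1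
      simp
      ring
    simp only [this]
    rw [← Complex.exp_sum]
    congr 1
    push_cast
    rw [← Finset.sum_div, Finset.sum_neg_distrib]
  -- Cramér–Wold: the value at `t` comes from the linear form with coefficients `c`.
  set c : ∀ n, Fin n → ℝ := fun n i => ∑ k, t k * U n k i with hc
  have hproj : ∀ n, charFun ((P n).map fun ω =>
        (WithLp.toLp 2 fun k => ∑ i, U n k i * w n ω i : EuclideanSpace ℝ (Fin K))) t
      = charFun ((P n).map fun ω => ∑ i, c n i * w n ω i) 1 := by
    intro n
    rw [charFun_apply, charFun_apply_real, integral_map (hXm n) (by fun_prop),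
      integral_map (Finset.aemeasurable_fun_sum _ fun i _ => (hwm n i).const_mul _) (by fun_prop)]
    congr 1
    ext ω
    congr 2
    simp only [PiLp.inner_apply, hc, Complex.ofReal_one, one_mul]
    congr 1
    simp only [Finset.sum_mul, RCLike.inner_apply, conj_trivial, Finset.mul_sum]
    rw [Finset.sum_comm]
    exact Finset.sum_congr rfl fun i _ => Finset.sum_congr rfl fun k _ => by ring
  have hcsq : ∀ᶠ n in atTop, ∑ i, c n i ^ 2 = ∑ k, t k ^ 2 := by
    filter_upwards [hU] with n hn
    calc ∑ i, c n i ^ 2 = ∑ k, ∑ l, t k * t l * ∑ i, U n k i * U n l i := by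
          have hsq : ∀ i, c n i ^ 2 = ∑ k, ∑ l, t k * U n k i * (t l * U n l i) :=
            fun i => by rw [sq, hc, Finset.sum_mul_sum]
          simp only [hsq, Finset.mul_sum]
          rw [Finset.sum_comm]
          refine Finset.sum_congr rfl fun k _ => ?_
          rw [Finset.sum_comm]
          exact Finset.sum_congr rfl fun l _ => Finset.sum_congr rfl fun i _ => by ring
      _ = ∑ k, t k ^ 2 := by simp [hn, sq]
  set m : ℕ → ℝ := fun n => (∑ k, |t k|) * r n with hm
  have hm0 : Tendsto m atTop (𝓝 0) := by simpa using hr.const_mul (∑ k, |t k|)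
  have hcm : ∀ᶠ n in atTop, ∀ i, |c n i| ≤ m n := by
    filter_upwards [hUr] with n hn i
    refine (Finset.abs_sum_le_sum_abs _ _).trans ?_
    simp only [hm, Finset.sum_mul]
    refine Finset.sum_le_sum fun k _ => ?_
    rw [abs_mul]
    exact mul_le_mul_of_nonneg_left (hn k i) (abs_nonneg _)
  have key : Tendsto (fun n => charFun ((P n).map fun ω => ∑ i, c n i * w n ω i) 1
      - Complex.exp (-((∑ k, t k ^ 2 : ℝ) : ℂ) / 2)) atTop (𝓝 0) := by
    refine squeeze_zero_norm'
      (a := fun n => (4 * (1 + M) + 1) * m n * ∑ k, t k ^ 2) ?_ ?_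
    · filter_upwards [hcsq, hcm, hm0.eventually_le_const one_pos] with n h1 h2 h3
      have := (hw n).norm_charFun_linear_sub_le (c n) h2 h3
      rwa [h1] at this
    · simpa using (hm0.const_mul (4 * (1 + M) + 1)).mul_const (∑ k, t k ^ 2)
  have key' := key.add_const (Complex.exp (-((∑ k, t k ^ 2 : ℝ) : ℂ) / 2))
  simp only [sub_add_cancel, zero_add] at key'
  simp only [ProbabilityMeasure.coe_mk, hproj, hlim]
  exact key'

/-! ### The quadratic form `δ` -/

section Delta

variable {Ω : Type*} [MeasurableSpace Ω] {n : ℕ} {ε w : Ω → Fin n → ℝ} {P : Measure Ω} {Kw : ℝ}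

theorem SubGaussianErrors.aemeasurable_delta (h : SubGaussianErrors ε w P Kw) :
    AEMeasurable (delta ε w P) P := by
  have hw := h.aemeasurable
  unfold delta
  simp only [Matrix.mulVec, dotProduct]
  fun_prop

/-- If spectral components with weights `β` are removed from `δ`, then the variance of what is left
is governed by the squared distances of the normalized eigenvalues from `β`. -/
theorem SubGaussianErrors.delta_sub_components [IsProbabilityMeasure P]
    (h : SubGaussianErrors ε w P Kw) (hK : 0 < Kw) (hn : 0 < n) {b : Fin n → Fin n → ℝ}
    (hb : ∀ k l, ∑ i, b k i * b l i = if k = l then 1 else 0)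
    (hV : ∀ i j, errV ε P i j
      = ∑ k : Fin n, eigval (errV_isHermitian ε P) k * (b k i * b k j)) (β : Fin n → ℝ) :
    MemLp (fun ω => delta ε w P ω
      - (∑ k, β k * (∑ i, b k i * w ω i) ^ 2 + (1 - ∑ k, β k))) 2 P ∧
    ∫ ω, (delta ε w P ω - (∑ k, β k * (∑ i, b k i * w ω i) ^ 2 + (1 - ∑ k, β k))) ∂P = 0 ∧
    ∫ ω, (delta ε w P ω - (∑ k, β k * (∑ i, b k i * w ω i) ^ 2 + (1 - ∑ k, β k))) ^ 2 ∂P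
      ≤ (4 * (Kw + 1) ^ 4 + 2)
        * ∑ k : Fin n, (eigval (errV_isHermitian ε P) k / n - β k) ^ 2 := by
  set lam : Fin n → ℝ := fun k => eigval (errV_isHermitian ε P) k / n with hlam
  have hn' : (n : ℝ) ≠ 0 := by positivity
  have hsum : ∑ k, lam k = 1 := by
    rw [hlam, ← Finset.sum_div, h.sum_eigval hn, div_self hn']
  have hdelta : ∀ ω, delta ε w P ω = ∑ k, lam k * (∑ i, b k i * w ω i) ^ 2 := by
    intro ω
    rw [← sum_mul_of_spectral]
    simp only [delta, Matrix.mulVec, dotProduct, hV, hlam, Finset.sum_div, Finset.mul_sum,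
      Finset.sum_mul]
    refine Finset.sum_congr rfl fun i _ => Finset.sum_congr rfl fun j _ =>
      Finset.sum_congr rfl fun k _ => ?_
    ring
  have hR : ∀ ω, delta ε w P ω - (∑ k, β k * (∑ i, b k i * w ω i) ^ 2 + (1 - ∑ k, β k))
      = ∑ i, ∑ j, (∑ k, (lam k - β k) * (b k i * b k j)) * (w ω i * w ω j)
        - ∑ i, ∑ k, (lam k - β k) * (b k i * b k i) := by
    intro ω
    rw [hdelta, sum_mul_of_spectral, sum_diag_of_orthonormal hb]
    simp only [sub_mul, Finset.sum_sub_distrib, hsum]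
    ring
  have key := (h.indepStandardized hK).integral_quadratic_sq_le
    (fun i j => ∑ k, (lam k - β k) * (b k i * b k j))
    (fun i j => Finset.sum_congr rfl fun k _ => by ring) Finset.univ
  simp only [sum_sq_of_orthonormal hb] at key
  simp only [hR]
  exact key

/-- The eigenvectors for large eigenvalues are delocalized, because `λₖ bₖ(i)² ≤ Vᵢᵢ` and the
diagonal of `V` is bounded by the ratio of the variance bounds. -/
theorem SubGaussianErrors.abs_eigenvector_le (h : SubGaussianErrors ε w P Kw) {Vlo Vup : ℝ}
    (hlo : 0 < Vlo) (hvar : ∀ i, variance (fun ω => ε ω i) P ∈ Set.Icc Vlo Vup)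
    {b : Fin n → Fin n → ℝ}
    (hV : ∀ i j, errV ε P i j
      = ∑ k : Fin n, eigval (errV_isHermitian ε P) k * (b k i * b k j))
    (k i : Fin n) (hk : 0 < eigval (errV_isHermitian ε P) k) :
    |b k i| ≤ √(Vup / Vlo / eigval (errV_isHermitian ε P) k) := by
  refine Real.le_sqrt_of_sq_le ?_
  rw [sq_abs, le_div_iff₀ hk]
  refine le_trans ?_ (h.errV_diag_le hlo hvar i)
  rw [hV i i]
  refine le_trans (le_of_eq ?_) (Finset.single_le_sum (fun l _ => ?_) (Finset.mem_univ k))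
  · ring
  · exact mul_nonneg (eigval_nonneg h.posDef.posSemidef l) (mul_self_nonneg _)

theorem sum_dite_lt {K n : ℕ} (hKn : K ≤ n) (G : Fin K → ℝ) :
    ∑ k : Fin n, (if h : (k : ℕ) < K then G ⟨k, h⟩ else 0) = ∑ k, G k := by
  obtain ⟨m, rfl⟩ := Nat.exists_eq_add_of_le hKn
  rw [Fin.sum_univ_add]
  simp

/-- The squared distances of the normalized eigenvalues from the spikes `α`: beyond the first `K`
eigenvalues, `∑ (λₖ / n)² ≤ (λ_{K+1} / n) ∑ λₖ / n`, and the last sum is at most one. -/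
theorem SubGaussianErrors.sum_sq_sub_le (h : SubGaussianErrors ε w P Kw) (hn : 0 < n) {K : ℕ}
    (hKn : K ≤ n) (α : Fin K → ℝ) :
    ∑ k : Fin n, (eigval (errV_isHermitian ε P) k / n
        - if hk : (k : ℕ) < K then α ⟨k, hk⟩ else 0) ^ 2
      ≤ ∑ k : Fin K, (eigval (errV_isHermitian ε P) k / n - α k) ^ 2
        + eigval (errV_isHermitian ε P) K / n := by
  have hps := h.posDef.posSemidef
  have hn' : (0 : ℝ) < n := by positivity
  have hpos : ∀ k, 0 ≤ eigval (errV_isHermitian ε P) k / n :=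
    fun k => div_nonneg (eigval_nonneg hps k) hn'.le
  have hsum : ∑ k : Fin n, eigval (errV_isHermitian ε P) k / n = 1 := by
    rw [← Finset.sum_div, h.sum_eigval hn, div_self hn'.ne']
  rw [← sum_dite_lt hKn, ← mul_one (eigval (errV_isHermitian ε P) K / n), ← hsum, Finset.mul_sum,
    ← Finset.sum_add_distrib]
  refine Finset.sum_le_sum fun k _ => ?_
  split_ifs with hk
  · exact le_add_of_nonneg_right (mul_nonneg (hpos _) (hpos _))
  · rw [sub_zero, sq, zero_add]
    refine mul_le_mul_of_nonneg_right ?_ (hpos _)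
    exact div_le_div_of_nonneg_right (eigval_antitone hps (not_lt.1 hk)) hn'.le

end Delta

end CorrelatedErrors

theorem lemmaA2
    {Ω : ℕ → Type*} [∀ n, MeasurableSpace (Ω n)]
    (P : ∀ n, Measure (Ω n)) [∀ n, IsProbabilityMeasure (P n)]
    (ε w : ∀ n, Ω n → Fin n → ℝ) (Kw : ℝ) (hKw : 0 < Kw)
    (herr : ∀ n, CorrelatedErrors.SubGaussianErrors (ε n) (w n) (P n) Kw)
    (ι : ℝ) (hι : ι ∈ Set.Icc (0 : ℝ) 1)
    (hmax : (fun n : ℕ => CorrelatedErrors.eigval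
        (CorrelatedErrors.errV_isHermitian (ε n) (P n)) 0) =Θ[atTop] fun n : ℕ => (n : ℝ) ^ ι) :
    -- Part (a): convergence in probability to `1`.
    (ι < 1 → ∀ η : ℝ, 0 < η →
      Tendsto (fun n : ℕ => P n {ω | η ≤ |CorrelatedErrors.delta (ε n) (w n) (P n) ω - 1|})
        atTop (𝓝 0)) ∧
    -- Part (b): convergence in distribution to a weighted sum of chi-squares.
    (ι = 1 → ∀ (K : ℕ) (α : Fin K → ℝ),
      (∀ i, α i ∈ Set.Ioc (0 : ℝ) 1) → (∑ i, α i) ∈ Set.Ioc (0 : ℝ) 1 →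
      (∀ i : Fin K, Tendsto (fun n : ℕ => CorrelatedErrors.eigval
        (CorrelatedErrors.errV_isHermitian (ε n) (P n)) i / n) atTop (𝓝 (α i))) →
      (∀ i : ℕ, K ≤ i → Tendsto (fun n : ℕ => CorrelatedErrors.eigval
        (CorrelatedErrors.errV_isHermitian (ε n) (P n)) i / n) atTop (𝓝 0)) →
      ∀ Vlo Vup : ℝ, 0 < Vlo → 0 < Vup →
      (∀ (n : ℕ) (i : Fin n), variance (fun ω => ε n ω i) (P n) ∈ Set.Icc Vlo Vup) →
      ∀ {Ω' : Type*} [MeasurableSpace Ω'] (P' : Measure Ω') [IsProbabilityMeasure P']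
        (Z : Fin K → Ω' → ℝ),
        iIndepFun Z P' → (∀ i, HasLaw (Z i) (gaussianReal 0 1) P') →
        TendstoInDistribution (fun n : ℕ => CorrelatedErrors.delta (ε n) (w n) (P n)) atTop
          (fun ω' => (∑ i, α i * Z i ω' ^ 2) + (1 - ∑ i, α i)) P P') := by
  open CorrelatedErrors in
  choose b hb hV using fun n => exists_spectral_decomposition (errV_isHermitian (ε n) (P n))
  set M : ℝ := 4 * (Kw + 1) ^ 4 with hM
  refine ⟨fun hι1 η hη => ?_, ?_⟩
  · have hlam : Tendsto (fun n : ℕ => eigval (errV_isHermitian (ε n) (P n)) 0 / n)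
        atTop (𝓝 0) := by
      have h1 : (fun n : ℕ => (n : ℝ) ^ ι) =o[atTop] fun n : ℕ => (n : ℝ) := by
        have h0 := (tendsto_rpow_neg_atTop (sub_pos.2 hι1)).comp
          (tendsto_natCast_atTop_atTop (R := ℝ))
        refine isLittleO_of_tendsto' ?_ (h0.congr' ?_)
        · filter_upwards [eventually_gt_atTop 0] with n hn h
          have : (n : ℝ) ≠ 0 := by positivity
          exact absurd h this
        · filter_upwards [eventually_gt_atTop 0] with n hn
          have : (0 : ℝ) < n := by positivity
          rw [Function.comp, neg_sub, Real.rpow_sub_one this.ne']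
      exact (hmax.1.trans_isLittleO h1).tendsto_div_nhds_zero
    have hup : Tendsto (fun n : ℕ => ENNReal.ofReal
        ((M + 2) * (eigval (errV_isHermitian (ε n) (P n)) 0 / n) / η ^ 2)) atTop (𝓝 0) := by
      have := ENNReal.tendsto_ofReal ((hlam.const_mul (M + 2)).div_const (η ^ 2))
      simpa using this
    refine tendsto_of_tendsto_of_tendsto_of_le_of_le' tendsto_const_nhds hup
      (Eventually.of_forall fun _ => zero_le) ?_
    filter_upwards [eventually_gt_atTop 0] with n hn
    obtain ⟨m1, m2, m3⟩ :=
      (herr n).delta_sub_components hKw hn (hb n) (hV n) (fun _ => 0)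
    have hF := (herr n).sum_sq_sub_le hn (Nat.zero_le n) Fin.elim0
    simp only [zero_mul, Finset.sum_const_zero, sub_zero, zero_add] at m1 m2 m3
    simp only [not_lt_zero, dite_false, sub_zero, Finset.univ_eq_empty, Finset.sum_empty,
      zero_add] at hF
    have hcheb := meas_ge_le_variance_div_sq m1 hη
    simp only [m2, sub_zero] at hcheb
    refine hcheb.trans (ENNReal.ofReal_le_ofReal ?_)
    rw [variance_of_integral_eq_zero m1.aemeasurable m2]
    have : 0 ≤ M := by positivity
    gcongr
    refine m3.trans ?_
    gcongr
  · intro _ K α hα hαs hlam hlam0 Vlo Vup hlo hup hvar Ω' _ P' _ Z hZ hZg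
    -- Where `bₖ` does not exist, because `n ≤ k`, zero stands in; this concerns finitely many `n`.
    let U : ∀ n, Fin K → Fin n → ℝ := fun n k i =>
      if h : (k : ℕ) < n then b n ⟨k, h⟩ i else 0
    have hUb : ∀ n, K ≤ n → ∀ k : Fin K, ∃ h : (k : ℕ) < n, U n k = b n ⟨k, h⟩ := by
      intro n hn k
      have h : (k : ℕ) < n := k.2.trans_le hn
      exact ⟨h, by ext i; simp [U, h]⟩
    have hlamtop : ∀ k : Fin K, Tendsto (fun n : ℕ =>
        eigval (errV_isHermitian (ε n) (P n)) k) atTop atTop := by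
      intro k
      refine ((hlam k).pos_mul_atTop (hα k).1 tendsto_natCast_atTop_atTop).congr' ?_
      filter_upwards [eventually_gt_atTop 0] with n hn
      have : (n : ℝ) ≠ 0 := by positivity
      field_simp
    -- Since `λₖ bₖ(i)² ≤ Vᵢᵢ ≤ Vup / Vlo`, the leading eigenvectors are delocalized.
    let r : ℕ → ℝ := fun n =>
      ∑ k : Fin K, √(Vup / Vlo / eigval (errV_isHermitian (ε n) (P n)) k)
    have hr : Tendsto r atTop (𝓝 0) := by
      have : ∀ k : Fin K, Tendsto (fun n : ℕ =>
          √(Vup / Vlo / eigval (errV_isHermitian (ε n) (P n)) k)) atTop (𝓝 0) := by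
        intro k
        simpa using ((hlamtop k).const_div_atTop (Vup / Vlo)).sqrt
      simpa using tendsto_finsetSum Finset.univ fun k _ => this k
    have hUr : ∀ᶠ n in atTop, ∀ k i, |U n k i| ≤ r n := by
      have hpos : ∀ᶠ n in atTop, ∀ k : Fin K, 0 < eigval (errV_isHermitian (ε n) (P n)) k :=
        eventually_all.2 fun k => (hlamtop k).eventually_gt_atTop 0
      filter_upwards [hpos, eventually_ge_atTop K] with n hn hKn k i
      obtain ⟨hk, hUk⟩ := hUb n hKn k
      rw [hUk]
      refine ((herr n).abs_eigenvector_le hlo (hvar n) (hV n) ⟨k, hk⟩ i (hn k)).trans ?_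
      exact Finset.single_le_sum (f := fun k : Fin K =>
        √(Vup / Vlo / eigval (errV_isHermitian (ε n) (P n)) k))
        (fun _ _ => Real.sqrt_nonneg _) (Finset.mem_univ k)
    have hUo : ∀ᶠ n in atTop, ∀ k l, ∑ i, U n k i * U n l i = if k = l then 1 else 0 := by
      filter_upwards [eventually_ge_atTop K] with n hKn k l
      obtain ⟨hk, hUk⟩ := hUb n hKn k
      obtain ⟨hl, hUl⟩ := hUb n hKn l
      rw [hUk, hUl, hb]
      simp [Fin.ext_iff]
    have hclt := tendstoInDistribution_projections
      (fun n => (herr n).indepStandardized hKw) U hUo hr hUr hZ hZg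
    have hcomp := hclt.continuous_comp
      (g := fun x : EuclideanSpace ℝ (Fin K) => (∑ k, α k * x k ^ 2) + (1 - ∑ k, α k))
      (by fun_prop)
    have hcomponents : ∀ n, K ≤ n → ∀ ω,
        (∑ k : Fin K, α k * (∑ i, U n k i * w n ω i) ^ 2) + (1 - ∑ k, α k)
        = ∑ k : Fin n, (if h : (k : ℕ) < K then α ⟨k, h⟩ else 0)
            * (∑ i, b n k i * w n ω i) ^ 2
          + (1 - ∑ k : Fin n, if h : (k : ℕ) < K then α ⟨k, h⟩ else 0) := by
      intro n hKn ω
      rw [← sum_dite_lt hKn, ← sum_dite_lt hKn]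
      congr 1
      refine Finset.sum_congr rfl fun k _ => ?_
      split_ifs with hk
      · simp [U]
      · rw [zero_mul]
    refine tendstoInDistribution_of_integral_sub_sq hcomp
      (fun n => (herr n).aemeasurable_delta) ?_ ?_
    · filter_upwards [eventually_ge_atTop K, eventually_gt_atTop 0] with n hKn hn
      simp only [Function.comp, hcomponents n hKn]
      exact ((herr n).delta_sub_components hKw hn (hb n) (hV n) _).1
    · have hbound : Tendsto (fun n : ℕ => (M + 2) *
          (∑ k : Fin K, (eigval (errV_isHermitian (ε n) (P n)) k / n - α k) ^ 2
            + eigval (errV_isHermitian (ε n) (P n)) K / n)) atTop (𝓝 0) := by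
        have h1 := tendsto_finsetSum Finset.univ fun (k : Fin K) _ =>
          (((hlam k).sub_const (α k)).pow 2)
        simpa using (h1.add (hlam0 K le_rfl)).const_mul (M + 2)
      refine squeeze_zero' (Eventually.of_forall fun n => integral_nonneg fun ω => sq_nonneg _) ?_
        hbound
      filter_upwards [eventually_ge_atTop K, eventually_gt_atTop 0] with n hKn hn
      simp only [Function.comp, hcomponents n hKn]
      have : 0 ≤ M := by positivity
      refine ((herr n).delta_sub_components hKw hn (hb n) (hV n) _).2.2.trans ?_
      gcongr
      exact (herr n).sum_sq_sub_le hn hKn α
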